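/- Let $N$ be a finite set of $n$ agents and $M$ a finite set of indivisible items. Agent $i$ initially holds a bundle $E_i\subseteq M$, and every item is held by exactly one agent. A valuation is a function $v:2^M\to\mathbb R$ that is normalized ($v(\emptyset)=0$), non-decreasing and subadditive ($v(X\cup Y)\le v(X)+v(Y)$ for all $X,Y\subseteq M$). The valuations $v_i$ are drawn independently, $v_i\sim F_i$. For each $i$ let $MED_i$ be a median of the distribution of $v_i(E_i)$, i.e. $\Pr[v_i(E_i)\le MED_i]\ge\frac12$ and $\Pr[v_i(E_i)\ge MED_i]\ge\frac12$. Write $H_k=\sum_{j=1}^k\frac1j$ and $t=\max_i|E_i|$. An allocation is a family $(A_i)_{i\in N}$ of pairwise disjoint bundles. The *Combinatorial Median mechanism* is the following randomized direct revelation mechanism. 1. Each agent is put in $S$ (sellers) or $B=N\setminus S$ (buyers), independently and with probability $\frac12$ each. 2. Let $\hat S=\{i\in S: v_i(E_i)\le MED_i\}$ be the set of sellers who accept the price $MED_i$ for their endowment, and let $E_{\hat S}=\bigcup_{i\in\hat S}E_i$. 3. For an allocation $A$ of items of $E_{\hat S}$ to the agents of $B$, let $t_i(A)=|\{j: A_j\cap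 E_i\ne\emptyset\}|$ and $c_A=\sum_{i\in\hat S}H_{t_i(A)}\cdot MED_i$. Choose such an $A$ maximizing $\sum_{i\in B}v_i(A_i\cup E_i)-c_A$. Ties may be broken by any rule that depends only on $B$, $\hat S$ and the reports of the agents in $B$. 4. Each buyer $i\in B$ receives $A_i\cup E_i$ and pays her VCG payment, that is, the maximum of $\sum_{j\in B\setminus\{i\}}v_j(A'_j\cup E_j)-c_{A'}$ over allocations $A'$ of items of $E_{\hat S}$ to $B\setminus\{i\}$, minus $\sum_{j\in B\setminus\{i\}}v_j(A_j\cup E_j)-c_A$. Each seller $i\in\hat S$ with $A_j\cap E_i\neq\emptyset$ for some $j$ loses her whole endowment and is paid $MED_i$. Every other seller keeps $E_i$ and is paid nothing. The only knowledge about the distributions $F_i$ that the mechanism uses is the numbers $MED_i$. **Theorem 4.1.** For every choice of the tie-breaking rule the Combinatorial Median mechanism always outputs an allocation, and for every realization of its coins and every profile $v$ of valuations it is - truthful: reporting $v_i$ is a dominant strategy for every agent $i$; - ex-post individually rational: the value that $i$ assigns to her final bundle, minus her payment, is at least $v_i(E_i)$; - weakly budget balanced: the sum of all payments to the mechanism is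 nonnegative. Moreover it achieves an $8H_t$ approximation to the optimal expected welfare: if $ALG$ is its expected welfare (sum of the agents' values for their final bundles, in expectation over the valuations and the coins), then $$\mathbb E_v\Big[\max_{A}\sum_{i\in N}v_i(A_i)\Big]\;\le\; 8H_t\cdot ALG ,$$ where the maximum is over all allocations $A$, and expectations take values in $[0,\infty]$. -/

import Mathlib

open MeasureTheory
open scoped ENNReal

namespace CombExchange

/-- A valuation over bundles of items of `M` that is normalized, non-decreasing and subadditive.
In particular it is nonnegative. -/
structure IsValuation {M : Type*} [DecidableEq M] (v : Finset M → ℝ) : Prop where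
  normalized : v ∅ = 0
  mono : ∀ X Y : Finset M, X ⊆ Y → v X ≤ v Y
  subadditive : ∀ X Y : Finset M, v (X ∪ Y) ≤ v X + v Y

/-- The space of normalized, non-decreasing, subadditive valuations. -/
abbrev Valuation (M : Type*) [DecidableEq M] : Type _ := {v : Finset M → ℝ // IsValuation v}

section

variable {N M : Type*} [Fintype N] [DecidableEq N] [Fintype M] [DecidableEq M]

/-- `E` is an initial endowment: every item is initially held by exactly one agent. -/
def IsEndowment (E : N → Finset M) : Prop := ∀ x : M, ∃! i : N, x ∈ E i

/-- An allocation: the agents receive pairwise disjoint bundles. -/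
def IsAllocation (A : N → Finset M) : Prop := Pairwise fun i j => Disjoint (A i) (A j)

/-- Social welfare of an allocation. -/
def welfare (v : N → Valuation M) (A : N → Finset M) : ℝ := ∑ i, (v i).1 (A i)

/-- The optimal (first-best) social welfare for a given profile. -/
noncomputable def optWelfare (v : N → Valuation M) : ℝ≥0∞ :=
  ⨆ A : {A : N → Finset M // IsAllocation A}, ENNReal.ofReal (welfare v A.1)

/-! ### Randomized direct revelation mechanisms -/

/-- A randomized direct revelation mechanism with coins in `C`. For each realization of the coins
and each reported profile it outputs bundles and payments (a negative payment is a transfer from the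
mechanism to the agent). -/
structure RandMechanism (N M C : Type*) [DecidableEq M] where
  coin : PMF C
  alloc : C → (N → Valuation M) → N → Finset M
  pay : C → (N → Valuation M) → N → ℝ

namespace RandMechanism

variable {C : Type*} (μ : RandMechanism N M C)

/-- For every realization the outcome is an allocation. -/
def Feasible : Prop := ∀ c v, IsAllocation (μ.alloc c v)

/-- Ex-post dominant-strategy truthfulness: for every realization of the coins, reporting
the true valuation is a dominant strategy for every agent. -/
def Truthful : Prop :=
  ∀ (c : C) (v : N → Valuation M) (i : N) (w : Valuation M),
    (v i).1 (μ.alloc c (Function.update v i w) i) - μ.pay c (Function.update v i w) i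
      ≤ (v i).1 (μ.alloc c v i) - μ.pay c v i

/-- Ex-post individual rationality with respect to the initial endowment. -/
def ExPostIR (E : N → Finset M) : Prop :=
  ∀ (c : C) (v : N → Valuation M) (i : N),
    (v i).1 (E i) ≤ (v i).1 (μ.alloc c v i) - μ.pay c v i

/-- Ex-post weak budget balance. -/
def WeaklyBudgetBalanced : Prop :=
  ∀ (c : C) (v : N → Valuation M), 0 ≤ ∑ i, μ.pay c v i

/-- Expected welfare, over independent valuations `v i ∼ F i` and over the coins. -/
noncomputable def expWelfare (F : N → Measure (Valuation M)) : ℝ≥0∞ :=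
  ∫⁻ v, ∑' c, μ.coin c * ENNReal.ofReal (welfare v (μ.alloc c v)) ∂(Measure.pi F)

end RandMechanism

/-- `m` is a median of the distribution `P` on the reals. -/
def IsMedian (P : Measure ℝ) (m : ℝ) : Prop :=
  1 / 2 ≤ P (Set.Iic m) ∧ 1 / 2 ≤ P (Set.Ici m)

/-! ### The auction among the buyers

`B` is the set of buyers and `T` the set of sellers that accepted the offered price. -/

/-- Allocations of the items initially held by the members of `T` to the members of `B`. -/
noncomputable def auctionAllocs (E : N → Finset M) (B T : Finset N) : Finset (N → Finset M) :=
  open Classical in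
  Finset.univ.filter fun A =>
    IsAllocation A ∧ (∀ i, A i ⊆ T.biUnion E) ∧ ∀ i, i ∉ B → A i = ∅

/-- The number of agents that hold in `A` at least one item of seller `i`. -/
def numBuyers (E A : N → Finset M) (i : N) : ℕ :=
  (Finset.univ.filter fun j => (A j ∩ E i).Nonempty).card

/-- The penalty `c_A` of an allocation `A` of the items of the sellers in `T`. -/
noncomputable def penalty (E : N → Finset M) (med : N → ℝ) (T : Finset N)
    (A : N → Finset M) : ℝ :=
  ∑ i ∈ T, (harmonic (numBuyers E A i) : ℝ) * med i

/-- The penalized welfare of the buyers, who keep their own endowments. -/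
noncomputable def score (E : N → Finset M) (med : N → ℝ) (B T : Finset N)
    (v : N → Valuation M) (A : N → Finset M) : ℝ :=
  ∑ i ∈ B, (v i).1 (A i ∪ E i) - penalty E med T A

theorem mem_auctionAllocs {E : N → Finset M} {B T : Finset N} {A : N → Finset M} :
    A ∈ auctionAllocs E B T ↔
      IsAllocation A ∧ (∀ i, A i ⊆ T.biUnion E) ∧ ∀ i, i ∉ B → A i = ∅ := by
  classical
  simp [auctionAllocs]

theorem auctionAllocs_nonempty (E : N → Finset M) (B T : Finset N) :
    (auctionAllocs E B T).Nonempty :=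
  ⟨fun _ => ∅, mem_auctionAllocs.2 ⟨fun _ _ _ => Finset.disjoint_empty_left _,
    fun _ => Finset.empty_subset _, fun _ _ => rfl⟩⟩

/-- The maximal penalized welfare. -/
noncomputable def optScore (E : N → Finset M) (med : N → ℝ) (B T : Finset N)
    (v : N → Valuation M) : ℝ :=
  (auctionAllocs E B T).sup' (auctionAllocs_nonempty E B T) (score E med B T v)

/-- A rule that selects, from the reports of the buyers in `B` and the set `T` of accepting
sellers, an allocation of the sellers' items to the buyers that maximizes the penalized welfare.
Ties may be broken in any way that depends only on this information. -/
structure AuctionRule (E : N → Finset M) (med : N → ℝ) where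
  choose : Finset N → Finset N → (N → Valuation M) → N → Finset M
  mem : ∀ B T v, choose B T v ∈ auctionAllocs E B T
  optimal : ∀ B T v, ∀ A ∈ auctionAllocs E B T,
    score E med B T v A ≤ score E med B T v (choose B T v)
  congr : ∀ B T v w, (∀ i ∈ B, v i = w i) → choose B T v = choose B T w

instance AuctionRule.instNonempty (E : N → Finset M) (med : N → ℝ) :
    Nonempty (AuctionRule E med) := by
  have h : ∀ (B T : Finset N) (f : (N → Finset M) → ℝ),
      ∃ A ∈ auctionAllocs E B T, ∀ A' ∈ auctionAllocs E B T, f A' ≤ f A :=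
    fun B T f => Finset.exists_max_image _ f (auctionAllocs_nonempty E B T)
  choose g hg hopt using h
  refine ⟨⟨fun B T v => g B T (score E med B T v), fun B T v => hg _ _ _,
    fun B T v => hopt _ _ _, fun B T v w hvw => ?_⟩⟩
  have hs : score E med B T v = score E med B T w := by
    funext A
    simp only [score]
    rw [Finset.sum_congr rfl fun i hi => by rw [hvw i hi]]
  simp only [hs]

/-! ### The Combinatorial Median mechanism -/

/-- The sellers in `S` that accept the price `med i` for their whole endowment. -/
noncomputable def accepting (E : N → Finset M) (med : N → ℝ) (S : Finset N)
    (v : N → Valuation M) : Finset N :=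
  open Classical in S.filter fun i => (v i).1 (E i) ≤ med i

/-- The auction's allocation when `S` is the set of sellers and `Sᶜ` the set of buyers. -/
noncomputable def auctionOutcome {E : N → Finset M} {med : N → ℝ} (r : AuctionRule E med)
    (S : Finset N) (v : N → Valuation M) : N → Finset M :=
  r.choose Sᶜ (accepting E med S v) v

/-- Seller `i` trades: she accepted, and at least one of her items is sold. -/
def Sold {E : N → Finset M} {med : N → ℝ} (r : AuctionRule E med)
    (S : Finset N) (v : N → Valuation M) (i : N) : Prop :=
  i ∈ accepting E med S v ∧ ∃ j, (auctionOutcome r S v j ∩ E i).Nonempty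

/-- The VCG payment of buyer `i`: the maximal penalized welfare of the other buyers if `i` does
not take part, minus the penalized welfare of the other buyers in the chosen allocation. -/
noncomputable def vcgPay {E : N → Finset M} {med : N → ℝ} (r : AuctionRule E med)
    (S : Finset N) (v : N → Valuation M) (i : N) : ℝ :=
  optScore E med (Sᶜ.erase i) (accepting E med S v) v
    - score E med (Sᶜ.erase i) (accepting E med S v) v (auctionOutcome r S v)

/-- The Combinatorial Median mechanism. The coins choose the set `S` of sellers uniformly among all
sets of agents, that is, every agent is a seller or a buyer with probability one half,
independently. -/
noncomputable def combMedian {E : N → Finset M} {med : N → ℝ} (r : AuctionRule E med) :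
    RandMechanism N M (Finset N) where
  coin := PMF.uniformOfFintype (Finset N)
  alloc S v i :=
    open Classical in
    if i ∈ S then (if Sold r S v i then ∅ else E i) else auctionOutcome r S v i ∪ E i
  pay S v i :=
    open Classical in
    if i ∈ S then (if Sold r S v i then -med i else 0) else vcgPay r S v i

end

end CombExchange

/-! The Combinatorial Median mechanism is feasible, truthful, individually rational, weakly budget
balanced and an `8 H_t`-approximation.

**Incentives.** A seller's report only decides whether she accepts a posted price, and a buyer faces
a VCG auction: by `buyer_utility` she earns the total penalized welfare of the outcome minus a term
she does not influence. Leaving a buyer `i` without items keeps the values of the other buyers and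
lowers the penalty of seller `j` from `H_{t_j} med_j` to `H_{t_j - 1} med_j` if `i` buys from `j`.
Hence her VCG payment is at least the sum of `med_j / t_j` over these sellers (`le_vcgPay`), and the
`t_j` buyers of `j` together cover the price `med_j`.

**Approximation.** Let `W` be the expected welfare of the mechanism, `h = H_t`, and let
`V = 𝔼 ∑ i, v i (E i)`. Rationality and budget balance give `V ≤ W`. For fixed coins and
valuations, an arbitrary allocation `O` and an arbitrary set `U` of accepting sellers, the auction
could give every buyer the part of `O` in the endowments of `U`. As the penalty also contains the
prices of the sellers who trade, and these exceed their values, the welfare is at least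
`∑_{i ∈ B} v i (O i ∩ (E_U ∪ E i)) + ∑_{j ∈ S} v j (E j) - h ∑_{j ∈ U} med j`
(`sum_add_le_welfare`).

Each seller accepts with probability at least one half. Thinning the accepting sellers by further
coins makes `U` a uniformly random subset of `S`, independent of the valuations of the buyers. Since
the maximum of the first sum over `O` (`restrictedOpt`) depends on these valuations only, the
expectation can be taken separately over `U`. A subadditive function keeps, on average, half of its
value on a uniformly random subset. Applied to `U ⊆ S` and to `S`, together with the probability
one half of being a buyer, this bounds the expected first sum from below by one eighth of the
expected optimum. The second sum contributes `V / 2`. The third one costs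
`h / 4 * ∑ j, med j ≤ h / 2 * V`, because a median of a nonnegative variable is at most twice its
mean. So `𝔼 opt + 4 V ≤ 8 W + 4 h V`, which is `lintegral_optWelfare_add_le`, and `V ≤ W`,
`1 ≤ h` give `𝔼 opt ≤ (4 + 4 h) W ≤ 8 h W`.

The tie-breaking rule need not be measurable, so the integral defining the expected welfare of the
mechanism is a lower integral. For possibly non-measurable integrands it is still monotone and
superadditive, and it is additive when one of two summands is measurable; this suffices. -/

set_option linter.unusedSectionVars false

namespace CombExchange

section Mechanism

/-! ### Feasibility -/

variable {M : Type*} [DecidableEq M]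

theorem IsValuation.nonneg {v : Finset M → ℝ} (hv : IsValuation v) (X : Finset M) : 0 ≤ v X :=
  hv.normalized ▸ hv.mono ∅ X (Finset.empty_subset X)

variable {N : Type*}

theorem IsEndowment.disjoint {E : N → Finset M} (hE : IsEndowment E) {i j : N} (hij : i ≠ j) :
    Disjoint (E i) (E j) :=
  Finset.disjoint_left.2 fun x hi hj => hij ((hE x).unique hi hj)

theorem IsEndowment.disjoint_biUnion {E : N → Finset M} (hE : IsEndowment E)
    {T : Finset N} {i : N} (hi : i ∉ T) : Disjoint (T.biUnion E) (E i) :=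
  (Finset.disjoint_biUnion_left _ _ _).2 fun _ hj => hE.disjoint fun h => hi (h ▸ hj)

variable [Fintype N] [DecidableEq N] [Fintype M]

theorem mem_accepting {E : N → Finset M} {med : N → ℝ} {S : Finset N} {v : N → Valuation M}
    {i : N} : i ∈ accepting E med S v ↔ i ∈ S ∧ (v i).1 (E i) ≤ med i := by
  classical
  simp [accepting]

theorem accepting_congr {E : N → Finset M} {med : N → ℝ} {S : Finset N} {v w : N → Valuation M}
    (h : ∀ i ∈ S, v i = w i) : accepting E med S v = accepting E med S w := by
  ext i
  simp only [mem_accepting]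
  exact and_congr_right fun hi => by rw [h i hi]

theorem score_congr {E : N → Finset M} {med : N → ℝ} {B T : Finset N} {v w : N → Valuation M}
    (h : ∀ i ∈ B, v i = w i) : score E med B T v = score E med B T w := by
  funext A
  simp only [score]
  rw [Finset.sum_congr rfl fun i hi => by rw [h i hi]]

theorem optScore_congr {E : N → Finset M} {med : N → ℝ} {B T : Finset N} {v w : N → Valuation M}
    (h : ∀ i ∈ B, v i = w i) : optScore E med B T v = optScore E med B T w := by
  rw [optScore, optScore, score_congr h]

theorem score_eq_add_erase {E : N → Finset M} {med : N → ℝ} {B T : Finset N}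
    (v : N → Valuation M) (A : N → Finset M) {i : N} (hi : i ∈ B) :
    score E med B T v A = (v i).1 (A i ∪ E i) + score E med (B.erase i) T v A := by
  rw [score, score, ← Finset.add_sum_erase B _ hi]
  ring

theorem score_le_optScore {E : N → Finset M} {med : N → ℝ} {B T : Finset N}
    (v : N → Valuation M) {A : N → Finset M} (hA : A ∈ auctionAllocs E B T) :
    score E med B T v A ≤ optScore E med B T v :=
  Finset.le_sup' _ hA

variable {E : N → Finset M} {med : N → ℝ} (r : AuctionRule E med)

theorem auctionOutcome_mem (S : Finset N) (v : N → Valuation M) :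
    auctionOutcome r S v ∈ auctionAllocs E Sᶜ (accepting E med S v) :=
  r.mem _ _ _

theorem disjoint_auctionOutcome (hE : IsEndowment E) {S : Finset N} {v : N → Valuation M} {i : N}
    (hi : i ∉ accepting E med S v) (j : N) : Disjoint (auctionOutcome r S v j) (E i) :=
  Finset.disjoint_of_subset_left ((mem_auctionAllocs.1 (auctionOutcome_mem r S v)).2.1 j)
    (hE.disjoint_biUnion hi)

theorem combMedian_feasible (hE : IsEndowment E) : (combMedian r).Feasible := by
  classical
  intro S v i j hij
  have hA := (mem_auctionAllocs.1 (auctionOutcome_mem r S v)).1 hij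
  have hEij := hE.disjoint hij
  have hbuyer : ∀ k, k ∉ S → ∀ l, Disjoint (auctionOutcome r S v l) (E k) := fun k hk =>
    disjoint_auctionOutcome r hE fun h => hk (mem_accepting.1 h).1
  have hseller : ∀ k, ¬ Sold r S v k → ∀ l, Disjoint (auctionOutcome r S v l) (E k) := by
    intro k hk l
    by_cases hT : k ∈ accepting E med S v
    · rw [Finset.disjoint_iff_inter_eq_empty, ← Finset.not_nonempty_iff_eq_empty]
      exact fun h => hk ⟨hT, l, h⟩
    · exact disjoint_auctionOutcome r hE hT l
  simp only [combMedian]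
  by_cases hi : i ∈ S <;> by_cases hj : j ∈ S <;> simp only [hi, hj, if_true, if_false]
  · split_ifs <;> simp [hEij]
  · split_ifs with hs
    · exact Finset.disjoint_empty_left _
    · exact Finset.disjoint_union_right.2 ⟨(hseller i hs j).symm, hEij⟩
  · split_ifs with hs
    · exact Finset.disjoint_empty_right _
    · exact Finset.disjoint_union_left.2 ⟨hseller j hs i, hEij⟩
  · simp only [Finset.disjoint_union_left, Finset.disjoint_union_right]
    exact ⟨⟨hA, (hbuyer i hi j).symm⟩, hbuyer j hj i, hEij⟩

/-! ### Incentives -/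

/-- The utility of a buyer is the total penalized welfare of the outcome, measured with her true
valuation, minus a quantity that her report does not influence. -/
theorem buyer_utility {S : Finset N} {v w : N → Valuation M} {i : N} (hi : i ∉ S)
    (h : ∀ j, j ≠ i → w j = v j) :
    (v i).1 ((combMedian r).alloc S w i) - (combMedian r).pay S w i =
      score E med Sᶜ (accepting E med S v) v (auctionOutcome r S w) -
        optScore E med (Sᶜ.erase i) (accepting E med S v) v := by
  have hT : accepting E med S w = accepting E med S v :=
    accepting_congr fun j hj => h j fun hji => hi (hji ▸ hj)
  have hB : ∀ j ∈ Sᶜ.erase i, w j = v j := fun j hj => h j (Finset.ne_of_mem_erase hj)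
  simp only [combMedian, if_neg hi, vcgPay]
  rw [hT, score_congr hB, optScore_congr hB, score_eq_add_erase v _ (Finset.mem_compl.2 hi)]
  ring

theorem combMedian_truthful : (combMedian r).Truthful := by
  classical
  intro S v i w
  have hupd : ∀ j, j ≠ i → Function.update v i w j = v j := fun j hj =>
    Function.update_of_ne hj w v
  by_cases hi : i ∈ S
  · -- A seller's report matters only through whether she accepts the price.
    have hbuyers : ∀ j ∈ Sᶜ, Function.update v i w j = v j := fun j hj =>
      hupd j fun h => Finset.mem_compl.1 hj (h ▸ hi)
    simp only [combMedian, if_pos hi]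
    have hz := (v i).2.normalized
    by_cases hacc : (v i).1 (E i) ≤ med i
    · by_cases hw : w.1 (E i) ≤ med i
      · have hT : accepting E med S (Function.update v i w) = accepting E med S v := by
          ext j
          simp only [mem_accepting]
          refine and_congr_right fun _ => ?_
          rcases eq_or_ne j i with rfl | hj
          · simp [hacc, hw]
          · rw [hupd j hj]
        have hout : auctionOutcome r S (Function.update v i w) = auctionOutcome r S v := by
          rw [auctionOutcome, auctionOutcome, hT, r.congr _ _ _ _ hbuyers]
        have hS : Sold r S (Function.update v i w) i ↔ Sold r S v i := by
          rw [Sold, Sold, hT, hout]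
        simp only [hS, le_refl]
      · have hS : ¬ Sold r S (Function.update v i w) i := fun h =>
          hw (by simpa using (mem_accepting.1 h.1).2)
        rw [if_neg hS, if_neg hS]
        split_ifs <;> linarith
    · have hS : ¬ Sold r S v i := fun h => hacc (mem_accepting.1 h.1).2
      rw [if_neg hS, if_neg hS]
      split_ifs <;> linarith
  · rw [buyer_utility r hi hupd, buyer_utility r hi fun _ _ => rfl]
    refine sub_le_sub_right (r.optimal _ _ _ _ ?_) _
    have hT : accepting E med S (Function.update v i w) = accepting E med S v :=
      accepting_congr fun j hj => hupd j fun hji => hi (hji ▸ hj)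
    exact hT ▸ auctionOutcome_mem r S (Function.update v i w)

theorem auctionAllocs_mono {B B' T : Finset N} (h : B' ⊆ B) :
    auctionAllocs E B' T ⊆ auctionAllocs E B T := fun A hA => by
  rw [mem_auctionAllocs] at hA ⊢
  exact ⟨hA.1, hA.2.1, fun i hi => hA.2.2 i fun hi' => hi (h hi')⟩

theorem combMedian_exPostIR : (combMedian r).ExPostIR E := by
  classical
  intro S v i
  by_cases hi : i ∈ S
  · simp only [combMedian, if_pos hi]
    split_ifs with hs
    · have := (mem_accepting.1 hs.1).2
      rw [(v i).2.normalized]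
      linarith
    · simp
  · rw [buyer_utility r hi fun _ _ => rfl]
    -- Compare with the best outcome in which `i` receives no item.
    obtain ⟨A, hA, hopt⟩ := Finset.exists_mem_eq_sup' (auctionAllocs_nonempty E (Sᶜ.erase i)
      (accepting E med S v)) (score E med (Sᶜ.erase i) (accepting E med S v) v)
    have h1 : score E med Sᶜ (accepting E med S v) v A ≤
        score E med Sᶜ (accepting E med S v) v (auctionOutcome r S v) :=
      r.optimal _ _ _ _ (auctionAllocs_mono (Finset.erase_subset _ _) hA)
    rw [score_eq_add_erase v A (Finset.mem_compl.2 hi),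
      (mem_auctionAllocs.1 hA).2.2 i (Finset.notMem_erase _ _), Finset.empty_union] at h1
    rw [optScore, hopt]
    linarith

/-! ### Budget balance -/

theorem numBuyers_update_empty (A : N → Finset M) (i j : N) :
    numBuyers E (Function.update A i ∅) j + (if (A i ∩ E j).Nonempty then 1 else 0) =
      numBuyers E A j := by
  have h : (Finset.univ.filter fun k => (Function.update A i ∅ k ∩ E j).Nonempty) =
      (Finset.univ.filter fun k => (A k ∩ E j).Nonempty).erase i := by
    ext k
    rcases eq_or_ne k i with rfl | hk <;> simp [*]
  rw [numBuyers, numBuyers, h]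
  split_ifs with hi
  · exact Finset.card_erase_add_one (by simpa using hi)
  · rw [Finset.erase_eq_of_notMem (by simpa using hi), add_zero]

/-- Taking the bundle of `i` away lowers the penalty by `1 / t_j` times the price of every seller
`j` that `i` buys from. -/
theorem penalty_update_empty (T : Finset N) (A : N → Finset M) (i : N) :
    penalty E med T A - penalty E med T (Function.update A i ∅) =
      ∑ j ∈ T, if (A i ∩ E j).Nonempty then (numBuyers E A j : ℝ)⁻¹ * med j else 0 := by
  rw [penalty, penalty, ← Finset.sum_sub_distrib]
  refine Finset.sum_congr rfl fun j _ => ?_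
  have h := numBuyers_update_empty (E := E) A i j
  split_ifs at h ⊢ with hi
  · rw [← h, harmonic_succ]
    push_cast
    ring
  · rw [← h, add_zero, sub_self]

theorem le_vcgPay {S : Finset N} (v : N → Valuation M) (i : N) :
    (∑ j ∈ accepting E med S v, if (auctionOutcome r S v i ∩ E j).Nonempty then
      (numBuyers E (auctionOutcome r S v) j : ℝ)⁻¹ * med j else 0) ≤ vcgPay r S v i := by
  set A := auctionOutcome r S v with hAdef
  have hA := mem_auctionAllocs.1 (auctionOutcome_mem r S v)
  rw [← hAdef] at hA
  have hsub : ∀ k, Function.update A i ∅ k ⊆ A k := fun k => by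
    rcases eq_or_ne k i with rfl | hk <;> simp [*]
  have hmem : Function.update A i ∅ ∈ auctionAllocs E (Sᶜ.erase i) (accepting E med S v) := by
    refine mem_auctionAllocs.2 ⟨fun k l hkl => Finset.disjoint_of_subset_left (hsub k)
      (Finset.disjoint_of_subset_right (hsub l) (hA.1 hkl)), fun k => (hsub k).trans (hA.2.1 k),
      fun k hk => ?_⟩
    rcases eq_or_ne k i with rfl | hki
    · simp
    · rw [Function.update_of_ne hki]
      exact hA.2.2 k fun h => hk (Finset.mem_erase.2 ⟨hki, h⟩)
  have h := score_le_optScore (med := med) v hmem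
  have hsum : ∑ k ∈ Sᶜ.erase i, (v k).1 (Function.update A i ∅ k ∪ E k) =
      ∑ k ∈ Sᶜ.erase i, (v k).1 (A k ∪ E k) :=
    Finset.sum_congr rfl fun k hk => by rw [Function.update_of_ne (Finset.ne_of_mem_erase hk)]
  rw [← penalty_update_empty, vcgPay, ← hAdef]
  rw [score, hsum] at h
  rw [score]
  linarith

open Classical in
/-- The buyers' payments cover what the sellers receive: seller `j` with `t_j > 0` buyers collects
`1 / t_j` of her price from each of them. -/
theorem sum_sold_le_sum_vcgPay (S : Finset N) (v : N → Valuation M) :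
    (∑ j ∈ S, if Sold r S v j then med j else 0) ≤ ∑ i ∈ Sᶜ, vcgPay r S v i := by
  set A := auctionOutcome r S v with hAdef
  set T := accepting E med S v with hTdef
  have hA := mem_auctionAllocs.1 (auctionOutcome_mem r S v)
  rw [← hAdef] at hA
  refine le_trans (le_of_eq ?_) (Finset.sum_le_sum fun i _ => le_vcgPay r v i)
  rw [Finset.sum_comm, ← hAdef]
  have hTS : T ⊆ S := fun j hj => (mem_accepting.1 hj).1
  rw [← Finset.sum_subset hTS fun j _ hj => if_neg fun h => hj h.1]
  refine Finset.sum_congr rfl fun j hj => ?_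
  have hcard : (Sᶜ.filter fun i => (A i ∩ E j).Nonempty) =
      Finset.univ.filter fun i => (A i ∩ E j).Nonempty := by
    ext i
    simp only [Finset.mem_filter, Finset.mem_univ, true_and, and_iff_right_iff_imp]
    intro h
    by_contra hi
    rw [hA.2.2 i hi] at h
    simp at h
  rw [← Finset.sum_filter, Finset.sum_const, hcard, nsmul_eq_mul]
  change _ = (numBuyers E A j : ℝ) * _
  split_ifs with hs
  · obtain ⟨_, k, hk⟩ := hs
    have : numBuyers E A j ≠ 0 :=
      Finset.card_ne_zero.2 ⟨k, by simpa using hk⟩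
    field_simp
  · have : numBuyers E A j = 0 :=
      Finset.card_eq_zero.2 (Finset.filter_eq_empty_iff.2 fun k _ hk => hs ⟨hj, k, hk⟩)
    simp [this]

theorem combMedian_weaklyBudgetBalanced : (combMedian r).WeaklyBudgetBalanced := by
  classical
  intro S v
  have h := sum_sold_le_sum_vcgPay r S v
  rw [← Finset.sum_add_sum_compl S]
  have h1 : ∑ i ∈ S, (combMedian r).pay S v i = -∑ j ∈ S, if Sold r S v j then med j else 0 := by
    rw [← Finset.sum_neg_distrib]
    refine Finset.sum_congr rfl fun i hi => ?_
    simp only [combMedian, if_pos hi]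
    split_ifs <;> simp
  have h2 : ∑ i ∈ Sᶜ, (combMedian r).pay S v i = ∑ i ∈ Sᶜ, vcgPay r S v i :=
    Finset.sum_congr rfl fun i hi => by simp only [combMedian, if_neg (Finset.mem_compl.1 hi)]
  rw [h1, h2]
  linarith

end Mechanism

section Welfare

variable {N M : Type*} [Fintype N] [DecidableEq N] [Fintype M] [DecidableEq M]
variable {E : N → Finset M} {med : N → ℝ} (r : AuctionRule E med)

/-! ### Welfare for fixed coins and valuations -/

theorem welfare_nonneg (v : N → Valuation M) (A : N → Finset M) : 0 ≤ welfare v A :=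
  Finset.sum_nonneg fun i _ => (v i).2.nonneg _

/-- The utilities add up to at least the initial welfare by individual rationality, and to at most
the final welfare by budget balance. -/
theorem welfare_endowment_le (S : Finset N) (v : N → Valuation M) :
    welfare v E ≤ welfare v ((combMedian r).alloc S v) := by
  have h := Finset.sum_le_sum fun i (_ : i ∈ Finset.univ) => combMedian_exPostIR r S v i
  rw [Finset.sum_sub_distrib] at h
  have := combMedian_weaklyBudgetBalanced r S v
  rw [welfare, welfare]
  linarith

theorem harmonic_monotone : Monotone harmonic :=
  monotone_nat_of_le_succ fun n => by
    rw [harmonic_succ]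
    exact le_add_of_nonneg_right (by positivity)

theorem one_le_harmonic {n : ℕ} (hn : n ≠ 0) : 1 ≤ harmonic n :=
  le_trans (by simp [harmonic]) (harmonic_monotone (Nat.one_le_iff_ne_zero.2 hn))

/-- The prices paid to the sellers who trade are part of the penalty and exceed their values, so
the welfare is at least the maximal penalized welfare plus the sellers' initial value. -/
theorem score_add_le_welfare (hmed : ∀ i, 0 ≤ med i) (S : Finset N) (v : N → Valuation M) :
    score E med Sᶜ (accepting E med S v) v (auctionOutcome r S v) + ∑ j ∈ S, (v j).1 (E j) ≤
      welfare v ((combMedian r).alloc S v) := by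
  classical
  set T := accepting E med S v with hT
  have hTS : T ⊆ S := fun j hj => (mem_accepting.1 hj).1
  have hbuyers : ∑ i ∈ Sᶜ, (v i).1 ((combMedian r).alloc S v i) =
      ∑ i ∈ Sᶜ, (v i).1 (auctionOutcome r S v i ∪ E i) :=
    Finset.sum_congr rfl fun i hi => by simp only [combMedian, if_neg (Finset.mem_compl.1 hi)]
  have hH : ∀ k : ℕ, 0 ≤ (harmonic k : ℝ) := fun k => by
    exact_mod_cast harmonic_monotone (Nat.zero_le k)
  have hpen : ∑ j ∈ S, (v j).1 (E j) ≤ penalty E med T (auctionOutcome r S v) +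
      ∑ j ∈ S, (v j).1 ((combMedian r).alloc S v j) := by
    have hext : penalty E med T (auctionOutcome r S v) = ∑ j ∈ S, if j ∈ T then
        (harmonic (numBuyers E (auctionOutcome r S v) j) : ℝ) * med j else 0 := by
      rw [penalty, ← Finset.sum_filter, Finset.filter_mem_eq_inter,
        Finset.inter_eq_right.2 hTS]
    rw [hext, ← Finset.sum_add_distrib]
    refine Finset.sum_le_sum fun j hj => ?_
    simp only [combMedian, if_pos hj]
    by_cases hs : Sold r S v j
    · have hjT : j ∈ T := hs.1
      rw [if_pos hs, if_pos hjT, (v j).2.normalized, add_zero]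
      obtain ⟨k, hk⟩ := hs.2
      have hne : numBuyers E (auctionOutcome r S v) j ≠ 0 :=
        Finset.card_ne_zero.2 ⟨k, by simpa using hk⟩
      have h1 : (1 : ℝ) ≤ harmonic (numBuyers E (auctionOutcome r S v) j) := by
        exact_mod_cast one_le_harmonic hne
      calc (v j).1 (E j) ≤ 1 * med j := by rw [one_mul]; exact (mem_accepting.1 hjT).2
        _ ≤ _ := mul_le_mul_of_nonneg_right h1 (hmed j)
    · rw [if_neg hs]
      refine le_add_of_nonneg_left ?_
      split_ifs
      exacts [mul_nonneg (hH _) (hmed j), le_rfl]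
  rw [welfare, ← Finset.sum_compl_add_sum S, hbuyers, score]
  linarith

theorem numBuyers_le_card {A : N → Finset M} (hA : IsAllocation A) (j : N) :
    numBuyers E A j ≤ (E j).card := by
  calc numBuyers E A j
      = ∑ k ∈ Finset.univ.filter fun k => (A k ∩ E j).Nonempty, 1 := by simp [numBuyers]
    _ ≤ ∑ k ∈ Finset.univ.filter fun k => (A k ∩ E j).Nonempty, (A k ∩ E j).card :=
        Finset.sum_le_sum fun k hk => Finset.card_pos.2 (Finset.mem_filter.1 hk).2
    _ = ((Finset.univ.filter fun k => (A k ∩ E j).Nonempty).biUnion fun k => A k ∩ E j).card :=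
        (Finset.card_biUnion fun k _ l _ hkl => Finset.disjoint_of_subset_left
          Finset.inter_subset_left (Finset.disjoint_of_subset_right Finset.inter_subset_left
            (hA hkl))).symm
    _ ≤ (E j).card := Finset.card_le_card (Finset.biUnion_subset.2 fun _ _ =>
        Finset.inter_subset_right)

/-- The largest welfare of the agents outside `S` when each of them may use only the part of her
bundle that comes from her own endowment and the endowments of the agents in `U`. It depends only
on the valuations of the agents outside `S`. -/
noncomputable def restrictedOpt (E : N → Finset M) (S U : Finset N) (v : N → Valuation M) : ℝ≥0∞ :=
  ⨆ O : {O : N → Finset M // IsAllocation O},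
    ENNReal.ofReal (∑ i ∈ Sᶜ, (v i).1 (O.1 i ∩ (U.biUnion E ∪ E i)))

theorem restrictedOpt_congr {S : Finset N} (U : Finset N) {v w : N → Valuation M}
    (h : ∀ i, i ∉ S → v i = w i) : restrictedOpt E S U v = restrictedOpt E S U w := by
  refine iSup_congr fun O => ?_
  rw [Finset.sum_congr rfl fun i hi => by rw [h i (Finset.mem_compl.1 hi)]]

/-- If every seller in `U` accepts, then the buyers may be given the part of an arbitrary
allocation that lies in the endowments of `U`, and each seller in `U` contributes at most `H_t`
times her price to the penalty. -/
theorem sum_add_le_welfare (hE : IsEndowment E) (hmed : ∀ i, 0 ≤ med i) {S U : Finset N}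
    {v : N → Valuation M} (hU : U ⊆ accepting E med S v) {O : N → Finset M}
    (hO : IsAllocation O) :
    ∑ i ∈ Sᶜ, (v i).1 (O i ∩ (U.biUnion E ∪ E i)) + ∑ j ∈ S, (v j).1 (E j) ≤
      welfare v ((combMedian r).alloc S v) +
        (harmonic (Finset.univ.sup fun i => (E i).card) : ℝ) * ∑ j ∈ U, med j := by
  set A : N → Finset M := fun i => if i ∈ S then ∅ else O i ∩ U.biUnion E with hAdef
  have hAsub : ∀ i, A i ⊆ O i ∩ U.biUnion E := fun i => by
    simp only [hAdef]
    split_ifs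
    exacts [Finset.empty_subset _, subset_rfl]
  have hAalloc : IsAllocation A := fun i j hij =>
    Finset.disjoint_of_subset_left ((hAsub i).trans Finset.inter_subset_left)
      (Finset.disjoint_of_subset_right ((hAsub j).trans Finset.inter_subset_left) (hO hij))
  have hA : A ∈ auctionAllocs E Sᶜ (accepting E med S v) := by
    refine mem_auctionAllocs.2 ⟨hAalloc, fun i => (hAsub i).trans (Finset.inter_subset_right.trans
      (Finset.biUnion_subset_biUnion_of_subset_left _ hU)), fun i hi => ?_⟩
    rw [Finset.mem_compl, not_not] at hi
    simp [hAdef, hi]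
  have hpen : penalty E med (accepting E med S v) A ≤
      (harmonic (Finset.univ.sup fun i => (E i).card) : ℝ) * ∑ j ∈ U, med j := by
    have hzero : ∀ j ∈ accepting E med S v, j ∉ U →
        (harmonic (numBuyers E A j) : ℝ) * med j = 0 := fun j _ hj => by
      have : numBuyers E A j = 0 := by
        refine Finset.card_eq_zero.2 (Finset.filter_eq_empty_iff.2 fun k _ hk => ?_)
        refine hk.ne_empty (Finset.disjoint_iff_inter_eq_empty.1 ?_)
        exact Finset.disjoint_of_subset_left ((hAsub k).trans Finset.inter_subset_right)
          (hE.disjoint_biUnion hj)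
      simp [this]
    rw [penalty, ← Finset.sum_subset hU hzero, Finset.mul_sum]
    refine Finset.sum_le_sum fun j _ => mul_le_mul_of_nonneg_right ?_ (hmed j)
    exact_mod_cast harmonic_monotone ((numBuyers_le_card hAalloc j).trans
      (Finset.le_sup (f := fun i => (E i).card) (Finset.mem_univ j)))
  have hval : ∑ i ∈ Sᶜ, (v i).1 (O i ∩ (U.biUnion E ∪ E i)) ≤ ∑ i ∈ Sᶜ, (v i).1 (A i ∪ E i) := by
    refine Finset.sum_le_sum fun i hi => (v i).2.mono _ _ ?_
    simp only [hAdef, if_neg (Finset.mem_compl.1 hi)]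
    rw [Finset.inter_union_distrib_left]
    exact Finset.union_subset_union_right Finset.inter_subset_right
  have hopt := r.optimal _ _ v A hA
  have hw := score_add_le_welfare r hmed S v
  rw [auctionOutcome] at hw
  rw [score] at hopt
  linarith

theorem restrictedOpt_add_le (hE : IsEndowment E) (hmed : ∀ i, 0 ≤ med i) {S U : Finset N}
    {v : N → Valuation M} (hU : U ⊆ accepting E med S v) :
    restrictedOpt E S U v + ∑ j ∈ S, ENNReal.ofReal ((v j).1 (E j)) ≤
      ENNReal.ofReal (welfare v ((combMedian r).alloc S v)) +
        ENNReal.ofReal (harmonic (Finset.univ.sup fun i => (E i).card) : ℝ) *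
          ∑ j ∈ U, ENNReal.ofReal (med j) := by
  have hH : 0 ≤ (harmonic (Finset.univ.sup fun i => (E i).card) : ℝ) := by
    exact_mod_cast harmonic_monotone (Nat.zero_le _)
  have : Nonempty {O : N → Finset M // IsAllocation O} :=
    ⟨⟨fun _ => ∅, fun _ _ _ => Finset.disjoint_empty_left _⟩⟩
  rw [restrictedOpt, ENNReal.iSup_add]
  refine iSup_le fun O => ?_
  rw [← ENNReal.ofReal_sum_of_nonneg fun j _ => (v j).2.nonneg _,
    ← ENNReal.ofReal_sum_of_nonneg fun j _ => hmed j, ← ENNReal.ofReal_mul hH,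
    ← ENNReal.ofReal_add (Finset.sum_nonneg fun i _ => (v i).2.nonneg _)
      (Finset.sum_nonneg fun i _ => (v i).2.nonneg _),
    ← ENNReal.ofReal_add (welfare_nonneg _ _)
      (mul_nonneg hH (Finset.sum_nonneg fun i _ => hmed i))]
  exact ENNReal.ofReal_le_ofReal (sum_add_le_welfare r hE hmed hU O.2)

/-! ### Averaging over random subsets -/

theorem sum_powerset_sdiff {ι R : Type*} [DecidableEq ι] [AddCommMonoid R] (S : Finset ι)
    (f : Finset ι → R) : ∑ U ∈ S.powerset, f (S \ U) = ∑ U ∈ S.powerset, f U :=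
  Finset.sum_nbij' (S \ ·) (S \ ·) (by simp) (by simp)
    (fun _ hU => Finset.sdiff_sdiff_eq_self (Finset.mem_powerset.1 hU))
    (fun _ hU => Finset.sdiff_sdiff_eq_self (Finset.mem_powerset.1 hU)) (by simp)

theorem sum_powerset_add_sdiff {ι R : Type*} [DecidableEq ι] [AddCommMonoid R] (S : Finset ι)
    (f : Finset ι → R) :
    ∑ U ∈ S.powerset, (f U + f (S \ U)) = 2 • ∑ U ∈ S.powerset, f U := by
  rw [Finset.sum_add_distrib, sum_powerset_sdiff, two_nsmul]

/-- A uniformly random subset of `S` carries, in expectation, at least half of the value that a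
subadditive function has on `S`. -/
theorem two_pow_card_nsmul_le {ι R : Type*} [DecidableEq ι] [AddCommMonoid R] [PartialOrder R]
    [IsOrderedAddMonoid R] (S : Finset ι) {f : Finset ι → R}
    (h : ∀ U ⊆ S, f S ≤ f U + f (S \ U)) :
    2 ^ S.card • f S ≤ 2 • ∑ U ∈ S.powerset, f U := by
  rw [← sum_powerset_add_sdiff, ← Finset.card_powerset]
  exact Finset.card_nsmul_le_sum _ _ _ fun U hU => h U (Finset.mem_powerset.1 hU)

theorem two_nsmul_sum_powerset {ι R : Type*} [DecidableEq ι] [AddCommMonoid R] (S : Finset ι)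
    (x : ι → R) : 2 • ∑ U ∈ S.powerset, ∑ j ∈ U, x j = 2 ^ S.card • ∑ j ∈ S, x j := by
  rw [← sum_powerset_add_sdiff, ← Finset.card_powerset, ← Finset.sum_const]
  refine Finset.sum_congr rfl fun U hU => ?_
  rw [add_comm, Finset.sum_sdiff (Finset.mem_powerset.1 hU)]

theorem valuation_inter_le (S U : Finset N) (v : Valuation M) (X Y : Finset M) :
    v.1 (X ∩ (S.biUnion E ∪ Y)) ≤
      v.1 (X ∩ (U.biUnion E ∪ Y)) + v.1 (X ∩ ((S \ U).biUnion E ∪ Y)) := by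
  refine le_trans (v.2.mono _ _ ?_) (v.2.subadditive _ _)
  rw [← Finset.inter_union_distrib_left]
  refine Finset.inter_subset_inter_left ?_
  intro x hx
  simp only [Finset.mem_union, Finset.mem_biUnion, Finset.mem_sdiff] at hx ⊢
  rcases hx with ⟨j, hj, hx⟩ | hx
  · by_cases hjU : j ∈ U
    · exact Or.inl (Or.inl ⟨j, hjU, hx⟩)
    · exact Or.inr (Or.inl ⟨j, ⟨hj, hjU⟩, hx⟩)
  · exact Or.inl (Or.inr hx)

theorem restrictedOpt_le_add (S U : Finset N) (v : N → Valuation M) :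
    restrictedOpt E S S v ≤ restrictedOpt E S U v + restrictedOpt E S (S \ U) v := by
  refine iSup_le fun O => le_trans ?_ (add_le_add (le_iSup _ O) (le_iSup _ O))
  rw [← ENNReal.ofReal_add (Finset.sum_nonneg fun i _ => (v i).2.nonneg _)
    (Finset.sum_nonneg fun i _ => (v i).2.nonneg _), ← Finset.sum_add_distrib]
  exact ENNReal.ofReal_le_ofReal (Finset.sum_le_sum fun i _ => valuation_inter_le _ _ _ _ _)

/-- An agent is outside the random set `S` with probability one half, and given this, `S` carries
on average at least half of the value of her bundle. -/
theorem two_pow_card_mul_optWelfare_le (hE : IsEndowment E) (v : N → Valuation M) :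
    2 ^ Fintype.card N * optWelfare v ≤ 4 * ∑ S : Finset N, restrictedOpt E S S v := by
  rw [optWelfare, ENNReal.mul_iSup]
  refine iSup_le fun O => ?_
  have hbundle : ∀ i, 2 ^ Fintype.card N * (v i).1 (O.1 i) ≤
      4 * ∑ S ∈ (Finset.univ.erase i).powerset, (v i).1 (O.1 i ∩ (S.biUnion E ∪ E i)) := by
    intro i
    have h := two_pow_card_nsmul_le (Finset.univ.erase i)
      (f := fun S => (v i).1 (O.1 i ∩ (S.biUnion E ∪ E i)))
      fun U _ => valuation_inter_le _ U _ _ _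
    have hall : O.1 i ∩ ((Finset.univ.erase i).biUnion E ∪ E i) = O.1 i := by
      refine Finset.inter_eq_left.2 fun x _ => ?_
      obtain ⟨j, hj, _⟩ := hE x
      rcases eq_or_ne j i with rfl | hji
      · exact Finset.mem_union_right _ hj
      · exact Finset.mem_union_left _ (Finset.mem_biUnion.2
          ⟨j, Finset.mem_erase.2 ⟨hji, Finset.mem_univ _⟩, hj⟩)
    have hcard : (Finset.univ.erase i).card + 1 = Fintype.card N :=
      Finset.card_erase_add_one (Finset.mem_univ i)
    rw [hall, nsmul_eq_mul, nsmul_eq_mul] at h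
    rw [← hcard, pow_succ]
    push_cast at h
    linarith
  have hswap : ∑ S : Finset N, ∑ i ∈ Sᶜ, (v i).1 (O.1 i ∩ (S.biUnion E ∪ E i)) =
      ∑ i, ∑ S ∈ (Finset.univ.erase i).powerset, (v i).1 (O.1 i ∩ (S.biUnion E ∪ E i)) :=
    Finset.sum_comm' fun S i => by simp [Finset.subset_erase]
  have hreal : 2 ^ Fintype.card N * welfare v O.1 ≤
      4 * ∑ S : Finset N, ∑ i ∈ Sᶜ, (v i).1 (O.1 i ∩ (S.biUnion E ∪ E i)) := by
    rw [hswap, welfare, Finset.mul_sum, Finset.mul_sum]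
    exact Finset.sum_le_sum fun i _ => hbundle i
  calc 2 ^ Fintype.card N * ENNReal.ofReal (welfare v O.1)
      = ENNReal.ofReal (2 ^ Fintype.card N * welfare v O.1) := by
        rw [ENNReal.ofReal_mul (by positivity), ENNReal.ofReal_pow (by norm_num)]
        simp
    _ ≤ ENNReal.ofReal (4 * ∑ S : Finset N, ∑ i ∈ Sᶜ, (v i).1 (O.1 i ∩ (S.biUnion E ∪ E i))) :=
        ENNReal.ofReal_le_ofReal hreal
    _ = 4 * ∑ S : Finset N,
          ENNReal.ofReal (∑ i ∈ Sᶜ, (v i).1 (O.1 i ∩ (S.biUnion E ∪ E i))) := by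
        rw [ENNReal.ofReal_mul (by norm_num), ENNReal.ofReal_sum_of_nonneg fun S _ =>
          Finset.sum_nonneg fun i _ => (v i).2.nonneg _]
        simp
    _ ≤ 4 * ∑ S : Finset N, restrictedOpt E S S v := by
        gcongr with S
        exact le_iSup (fun O : {O : N → Finset M // IsAllocation O} =>
          ENNReal.ofReal (∑ i ∈ Sᶜ, (v i).1 (O.1 i ∩ (S.biUnion E ∪ E i)))) O

end Welfare

end CombExchange

section Probability

/-! ### Thinning and independence -/

/-- An event of probability at least one half can be thinned, by an independent coin, to one of
probability exactly one half; `a` is the conditional probability of the thinned event. -/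
theorem exists_thinning {Ω : Type*} [MeasurableSpace Ω] (P : Measure Ω) [IsProbabilityMeasure P]
    {s : Set Ω} (hs : MeasurableSet s) (h : 1 / 2 ≤ P s) :
    ∃ a : Ω → ℝ≥0∞, Measurable a ∧ (∀ x, a x ≤ 1) ∧ (∀ x, x ∉ s → a x = 0) ∧
      ∫⁻ x, a x ∂P = 2⁻¹ := by
  have hP0 : P s ≠ 0 := fun h0 => by simp [h0] at h
  have hPtop : P s ≠ ∞ := measure_ne_top P s
  rw [one_div] at h
  refine ⟨s.indicator fun _ => 2⁻¹ * (P s)⁻¹, measurable_const.indicator hs, fun x => ?_,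
    fun x hx => Set.indicator_of_notMem hx _, ?_⟩
  · refine (Set.indicator_le_self' (fun _ _ => zero_le) x).trans ?_
    calc 2⁻¹ * (P s)⁻¹ ≤ P s * (P s)⁻¹ := by gcongr
      _ = 1 := ENNReal.mul_inv_cancel hP0 hPtop
  · rw [lintegral_indicator_const hs, mul_assoc, ENNReal.inv_mul_cancel hP0 hPtop, mul_one]

/-- Under a product measure, a product of functions of the coordinates in `S` is independent of a
function of the other coordinates. -/
theorem lintegral_pi_prod_mul {ι Ω : Type*} [Fintype ι] [DecidableEq ι] [MeasurableSpace Ω]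
    (F : ι → Measure Ω) [∀ i, IsProbabilityMeasure (F i)] (S : Finset ι) {b : ι → Ω → ℝ≥0∞}
    (hb : ∀ i, Measurable (b i)) {g : (ι → Ω) → ℝ≥0∞} (hg : Measurable g)
    (hdep : ∀ v w : ι → Ω, (∀ i, i ∉ S → v i = w i) → g v = g w) :
    ∫⁻ v, (∏ j ∈ S, b j (v j)) * g v ∂(Measure.pi F) =
      (∏ j ∈ S, ∫⁻ x, b j x ∂(F j)) * ∫⁻ v, g v ∂(Measure.pi F) := by
  obtain ⟨v₀⟩ : Nonempty (ι → Ω) := (Measure.pi F).nonempty_of_neZero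
  have hcoord : ProbabilityTheory.iIndepFun (fun i (v : ι → Ω) => v i) (Measure.pi F) :=
    ProbabilityTheory.iIndepFun_pi (X := fun _ => id) fun _ => aemeasurable_id
  have hprod : ∫⁻ v, (∏ j ∈ S, b j (v j)) ∂(Measure.pi F) = ∏ j ∈ S, ∫⁻ x, b j x ∂(F j) := by
    rw [ProbabilityTheory.lintegral_prod_eq_prod_lintegral_of_indepFun S
      (fun j (v : ι → Ω) => b j (v j))
      (ProbabilityTheory.iIndepFun_pi fun i => (hb i).aemeasurable)
      fun i => (hb i).comp (measurable_pi_apply i)]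
    exact Finset.prod_congr rfl fun j _ =>
      (measurePreserving_eval F j).lintegral_comp (hb j)
  have hbm : Measurable fun v : ι → Ω => ∏ j ∈ S, b j (v j) :=
    Finset.measurable_fun_prod _ fun j _ => (hb j).comp (measurable_pi_apply j)
  -- Both factors are functions of the coordinates in `S` and in its complement, respectively;
  -- `g` is evaluated with the coordinates in `S` taken from a fixed point.
  let ext : (((Sᶜ : Finset ι) : Type _) → Ω) → ι → Ω := fun u i =>
    if h : i ∈ Sᶜ then u ⟨i, h⟩ else v₀ i
  have hext : Measurable ext := measurable_pi_iff.2 fun i => by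
    by_cases h : i ∈ Sᶜ
    · simpa only [ext, dif_pos h] using measurable_pi_apply _
    · simpa only [ext, dif_neg h] using measurable_const
  have hindep := (hcoord.indepFun_finset S Sᶜ disjoint_compl_right measurable_pi_apply).comp
    (φ := fun u : S → Ω => ∏ j : S, b j (u j)) (ψ := fun u => g (ext u))
    (Finset.measurable_fun_prod _ fun j _ => (hb j).comp (measurable_pi_apply j))
    (hg.comp hext)
  have h1 : ((fun u : S → Ω => ∏ j : S, b j (u j)) ∘ fun (v : ι → Ω) (i : S) => v i) =
      fun v => ∏ j ∈ S, b j (v j) :=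
    funext fun v => Finset.prod_coe_sort S fun j => b j (v j)
  have h2 : ((fun u => g (ext u)) ∘ fun (v : ι → Ω) (i : (Sᶜ : Finset ι)) => v i) = g :=
    funext fun v => hdep _ _ fun i hi => dif_pos (Finset.mem_compl.2 hi)
  rw [h1, h2] at hindep
  rw [ProbabilityTheory.lintegral_mul_eq_lintegral_mul_lintegral_of_indepFun'' hbm.aemeasurable
    hg.aemeasurable hindep, hprod]

/-- The lower integral of possibly non-measurable functions is superadditive. -/
theorem sum_lintegral_le_lintegral_sum {ι Ω : Type*} [MeasurableSpace Ω] (μ : Measure Ω)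
    (s : Finset ι) (f : ι → Ω → ℝ≥0∞) :
    ∑ i ∈ s, ∫⁻ x, f i x ∂μ ≤ ∫⁻ x, ∑ i ∈ s, f i x ∂μ := by
  classical
  induction s using Finset.induction_on with
  | empty => simp
  | insert i s hi ih =>
    simp only [Finset.sum_insert hi]
    exact (add_le_add_right ih _).trans (le_lintegral_add _ _)

end Probability

namespace CombExchange

section Approximation

variable {N M : Type*} [Fintype N] [DecidableEq N] [Fintype M] [DecidableEq M]
variable {E : N → Finset M} {med : N → ℝ}

/-! ### Measurability and medians -/

theorem measurable_valuation_apply (X : Finset M) : Measurable fun v : Valuation M => v.1 X :=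
  (measurable_pi_apply X).comp measurable_subtype_coe

theorem measurable_ofReal_apply (i : N) (X : Finset M) :
    Measurable fun v : N → Valuation M => ENNReal.ofReal ((v i).1 X) :=
  ((measurable_valuation_apply X).comp (measurable_pi_apply i)).ennreal_ofReal

theorem measurable_restrictedOpt (S U : Finset N) :
    Measurable (restrictedOpt E S U) :=
  Measurable.iSup fun _ => (Finset.measurable_fun_sum _ fun i _ =>
    (measurable_valuation_apply _).comp (measurable_pi_apply i)).ennreal_ofReal

theorem measurableSet_accept (i : N) :
    MeasurableSet {v : Valuation M | v.1 (E i) ≤ med i} :=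
  measurableSet_le (measurable_valuation_apply _) measurable_const

theorem IsMedian.nonneg {P : Measure (Valuation M)} {X : Finset M} {m : ℝ}
    (h : IsMedian (P.map fun v => v.1 X) m) : 0 ≤ m := by
  by_contra hm
  have h1 := h.1
  rw [Measure.map_apply (measurable_valuation_apply X) measurableSet_Iic] at h1
  have hempty : (fun v : Valuation M => v.1 X) ⁻¹' Set.Iic m = ∅ :=
    Set.eq_empty_of_forall_notMem fun v hv => hm ((v.2.nonneg X).trans hv)
  simp [hempty] at h1

/-- Markov's inequality: a median of a nonnegative variable is at most twice its mean. -/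
theorem IsMedian.ofReal_le {P : Measure (Valuation M)} {X : Finset M} {m : ℝ}
    (h : IsMedian (P.map fun v => v.1 X) m) :
    ENNReal.ofReal m ≤ 2 * ∫⁻ v, ENNReal.ofReal (v.1 X) ∂P := by
  have h2 := h.2
  rw [Measure.map_apply (measurable_valuation_apply X) measurableSet_Ici, one_div] at h2
  have hmarkov := mul_meas_ge_le_lintegral (μ := P)
    (measurable_valuation_apply X).ennreal_ofReal (ENNReal.ofReal m)
  have hsub : P ((fun v : Valuation M => v.1 X) ⁻¹' Set.Ici m) ≤
      P {v | ENNReal.ofReal m ≤ ENNReal.ofReal (v.1 X)} :=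
    measure_mono fun v hv => ENNReal.ofReal_le_ofReal hv
  calc ENNReal.ofReal m = 2 * (ENNReal.ofReal m * 2⁻¹) := by
        rw [mul_comm (ENNReal.ofReal m), ← mul_assoc, ENNReal.mul_inv_cancel (by simp) (by simp),
          one_mul]
    _ ≤ 2 * ∫⁻ v, ENNReal.ofReal (v.1 X) ∂P := by
        gcongr
        exact le_trans (by gcongr; exact h2.trans hsub) hmarkov

variable (r : AuctionRule E med)

/-! ### The approximation guarantee -/

/-- The welfare guarantee for a fixed set `S` of sellers. The set of accepting sellers is thinned
so that it becomes uniformly distributed among the subsets of `S` and independent of the buyers'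
valuations. It then carries half of the restricted optimum on average, and every price enters the
penalty with probability one half. -/
theorem lintegral_restrictedOpt_le (hE : IsEndowment E)
    (F : N → Measure (Valuation M)) [∀ i, IsProbabilityMeasure (F i)]
    (hmed : ∀ i, IsMedian ((F i).map fun v => v.1 (E i)) (med i)) (S : Finset N) :
    ∫⁻ v, restrictedOpt E S S v ∂(Measure.pi F) +
        2 * ∑ j ∈ S, ∫⁻ v, ENNReal.ofReal ((v j).1 (E j)) ∂(Measure.pi F) ≤
      2 * ∫⁻ v, ENNReal.ofReal (welfare v ((combMedian r).alloc S v)) ∂(Measure.pi F) +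
        ENNReal.ofReal (harmonic (Finset.univ.sup fun i => (E i).card) : ℝ) *
          ∑ j ∈ S, ENNReal.ofReal (med j) := by
  set h := ENNReal.ofReal (harmonic (Finset.univ.sup fun i => (E i).card) : ℝ)
  have hnn : ∀ i, 0 ≤ med i := fun i => (hmed i).nonneg
  have hacc : ∀ i, 1 / 2 ≤ F i {v | v.1 (E i) ≤ med i} := fun i => by
    have := (hmed i).1
    rwa [Measure.map_apply (measurable_valuation_apply _) measurableSet_Iic] at this
  choose a ham ha1 ha0 haint using fun i => exists_thinning (F i) (measurableSet_accept i) (hacc i)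
  -- `w U` is the conditional probability that the thinned set of accepting sellers is `U`.
  let w : Finset N → (N → Valuation M) → ℝ≥0∞ := fun U v =>
    ∏ j ∈ S, if j ∈ U then a j (v j) else 1 - a j (v j)
  have hw_sum : ∀ v, ∑ U ∈ S.powerset, w U v = 1 := fun v => by
    have h1 : ∏ j ∈ S, (a j (v j) + (1 - a j (v j))) = 1 :=
      Finset.prod_eq_one fun j _ => add_tsub_cancel_of_le (ha1 j _)
    rw [← h1, Finset.prod_add]
    refine Finset.sum_congr rfl fun U hU => ?_
    simp only [w]
    rw [Finset.prod_ite, Finset.filter_mem_eq_inter, Finset.filter_notMem_eq_sdiff,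
      Finset.inter_eq_right.2 (Finset.mem_powerset.1 hU)]
  have hw_zero : ∀ U ∈ S.powerset, ∀ v, ¬ U ⊆ accepting E med S v → w U v = 0 := by
    intro U hU v hUv
    obtain ⟨j, hj, hjv⟩ := Finset.not_subset.1 hUv
    have hjS := Finset.mem_powerset.1 hU hj
    refine Finset.prod_eq_zero hjS ?_
    rw [if_pos hj]
    exact ha0 j _ fun hle => hjv (mem_accepting.2 ⟨hjS, hle⟩)
  have hbm : ∀ (U : Finset N) (j : N),
      Measurable fun x => if j ∈ U then a j x else 1 - a j x := fun U j => by
    split_ifs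
    exacts [ham j, measurable_const.sub (ham j)]
  have hwm : ∀ U, Measurable (w U) := fun U =>
    Finset.measurable_fun_prod _ fun j _ => (hbm U j).comp (measurable_pi_apply j)
  have hw_int : ∀ U, ∀ g : (N → Valuation M) → ℝ≥0∞, Measurable g →
      (∀ v v', (∀ i, i ∉ S → v i = v' i) → g v = g v') →
      ∫⁻ v, w U v * g v ∂(Measure.pi F) = 2⁻¹ ^ S.card * ∫⁻ v, g v ∂(Measure.pi F) := by
    intro U g hg hdep
    simp only [w]
    rw [lintegral_pi_prod_mul F S (hbm U) hg hdep, Finset.prod_eq_pow_card fun j _ => ?_]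
    split_ifs
    · exact haint j
    · rw [lintegral_sub (ham j) (by rw [haint]; simp) (Filter.Eventually.of_forall (ha1 j)),
        haint, lintegral_one, measure_univ, ENNReal.one_sub_inv_two]
  set W : (N → Valuation M) → ℝ≥0∞ := fun v =>
    ENNReal.ofReal (welfare v ((combMedian r).alloc S v))
  set V : (N → Valuation M) → ℝ≥0∞ := fun v => ∑ j ∈ S, ENNReal.ofReal ((v j).1 (E j))
  have hVm : Measurable V := Finset.measurable_fun_sum _ fun j _ => measurable_ofReal_apply j _
  have hVint : ∫⁻ v, V v ∂(Measure.pi F) =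
      ∑ j ∈ S, ∫⁻ v, ENNReal.ofReal ((v j).1 (E j)) ∂(Measure.pi F) :=
    lintegral_finsetSum _ fun j _ => measurable_ofReal_apply j _
  have hpoint : ∀ v, ∑ U ∈ S.powerset, w U v * restrictedOpt E S U v + V v ≤
      W v + ∑ U ∈ S.powerset, w U v * (h * ∑ j ∈ U, ENNReal.ofReal (med j)) := by
    intro v
    calc ∑ U ∈ S.powerset, w U v * restrictedOpt E S U v + V v
        = ∑ U ∈ S.powerset, w U v * (restrictedOpt E S U v + V v) := by
          simp only [mul_add]
          rw [Finset.sum_add_distrib, ← Finset.sum_mul, hw_sum, one_mul]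
      _ ≤ ∑ U ∈ S.powerset, w U v * (W v + h * ∑ j ∈ U, ENNReal.ofReal (med j)) := by
          refine Finset.sum_le_sum fun U hU => ?_
          by_cases hUv : U ⊆ accepting E med S v
          · exact mul_le_mul_right (restrictedOpt_add_le r hE hnn hUv) _
          · simp [hw_zero U hU v hUv]
      _ = _ := by
          simp only [mul_add]
          rw [Finset.sum_add_distrib, ← Finset.sum_mul, hw_sum, one_mul]
  have hwr : ∀ U, Measurable fun v => w U v * restrictedOpt E S U v := fun U =>
    (hwm U).mul (measurable_restrictedOpt S U)
  have hint := lintegral_mono (μ := Measure.pi F) hpoint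
  rw [lintegral_add_right _ hVm, lintegral_finsetSum _ fun U _ => hwr U,
    lintegral_add_right _ (Finset.measurable_fun_sum _ fun U _ => (hwm U).mul_const _),
    lintegral_finsetSum _ fun U _ => (hwm U).mul_const _,
    Finset.sum_congr rfl fun U _ => hw_int U _ (measurable_restrictedOpt S U) fun v v' hv =>
      restrictedOpt_congr U hv,
    Finset.sum_congr rfl fun U _ => hw_int U _ measurable_const fun _ _ _ => rfl,
    ← Finset.mul_sum, ← Finset.mul_sum] at hint
  simp only [lintegral_const, measure_univ, mul_one] at hint
  have hpow : (2⁻¹ : ℝ≥0∞) ^ S.card * 2 ^ S.card = 1 := by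
    rw [← mul_pow, ENNReal.inv_mul_cancel (by simp) (by simp), one_pow]
  have hopt : ∫⁻ v, restrictedOpt E S S v ∂(Measure.pi F) ≤
      2 * (2⁻¹ ^ S.card * ∑ U ∈ S.powerset, ∫⁻ v, restrictedOpt E S U v ∂(Measure.pi F)) := by
    have hsub := two_pow_card_nsmul_le S
      (f := fun U => ∫⁻ v, restrictedOpt E S U v ∂(Measure.pi F)) fun U _ => by
        rw [← lintegral_add_left (measurable_restrictedOpt S U)]
        exact lintegral_mono fun v => restrictedOpt_le_add S U v
    rw [nsmul_eq_mul, nsmul_eq_mul] at hsub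
    push_cast at hsub
    calc ∫⁻ v, restrictedOpt E S S v ∂(Measure.pi F)
        = 2⁻¹ ^ S.card * (2 ^ S.card * ∫⁻ v, restrictedOpt E S S v ∂(Measure.pi F)) := by
          rw [← mul_assoc, hpow, one_mul]
      _ ≤ 2⁻¹ ^ S.card *
            (2 * ∑ U ∈ S.powerset, ∫⁻ v, restrictedOpt E S U v ∂(Measure.pi F)) := by
          gcongr
      _ = _ := by ring
  have hcost : 2 * (2⁻¹ ^ S.card *
      ∑ U ∈ S.powerset, h * ∑ j ∈ U, ENNReal.ofReal (med j)) =
        h * ∑ j ∈ S, ENNReal.ofReal (med j) := by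
    have hsum := two_nsmul_sum_powerset S fun j => ENNReal.ofReal (med j)
    rw [nsmul_eq_mul, nsmul_eq_mul] at hsum
    push_cast at hsum
    rw [← Finset.mul_sum]
    calc _ = 2⁻¹ ^ S.card * h *
          (2 * ∑ U ∈ S.powerset, ∑ j ∈ U, ENNReal.ofReal (med j)) := by ring
      _ = 2⁻¹ ^ S.card * 2 ^ S.card * (h * ∑ j ∈ S, ENNReal.ofReal (med j)) := by
          rw [hsum]
          ring
      _ = _ := by rw [hpow, one_mul]
  calc _ ≤ 2 * (2⁻¹ ^ S.card * ∑ U ∈ S.powerset, ∫⁻ v, restrictedOpt E S U v ∂(Measure.pi F)) +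
        2 * ∫⁻ v, V v ∂(Measure.pi F) := by
        rw [hVint]
        gcongr
    _ ≤ 2 * (∫⁻ v, W v ∂(Measure.pi F) + 2⁻¹ ^ S.card *
          ∑ U ∈ S.powerset, h * ∑ j ∈ U, ENNReal.ofReal (med j)) := by
        rw [← mul_add]
        gcongr
    _ = _ := by rw [mul_add, hcost]

/-- Only an inequality, as the welfare need not be measurable in the valuations. -/
theorem sum_lintegral_welfare_le (F : N → Measure (Valuation M)) :
    2⁻¹ ^ Fintype.card N * ∑ S : Finset N,
        ∫⁻ v, ENNReal.ofReal (welfare v ((combMedian r).alloc S v)) ∂(Measure.pi F) ≤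
      (combMedian r).expWelfare F := by
  have hcoin : ∀ S, (combMedian r).coin S = 2⁻¹ ^ Fintype.card N := fun S => by
    simp [combMedian, PMF.uniformOfFintype_apply, ENNReal.inv_pow]
  rw [RandMechanism.expWelfare]
  simp only [tsum_fintype, hcoin, ← Finset.mul_sum]
  exact le_trans (by gcongr; exact sum_lintegral_le_lintegral_sum _ _ _)
    (lintegral_const_mul_le _ _)

theorem lintegral_welfare_endowment_le (F : N → Measure (Valuation M)) :
    ∫⁻ v, ENNReal.ofReal (welfare v E) ∂(Measure.pi F) ≤ (combMedian r).expWelfare F := by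
  refine lintegral_mono fun v => ?_
  calc ENNReal.ofReal (welfare v E)
      = ∑' S, (combMedian r).coin S * ENNReal.ofReal (welfare v E) := by
        rw [ENNReal.tsum_mul_right, PMF.tsum_coe, one_mul]
    _ ≤ _ := by
        refine ENNReal.tsum_le_tsum fun S => ?_
        gcongr
        exact welfare_endowment_le r S v

/-- The sharper bound behind the approximation guarantee, in a form without subtraction: the
expected value `∑ i, 𝔼 [v i (E i)]` of the initial endowments occurs on both sides. -/
theorem lintegral_optWelfare_add_le (hE : IsEndowment E)
    (F : N → Measure (Valuation M)) [∀ i, IsProbabilityMeasure (F i)]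
    (hmed : ∀ i, IsMedian ((F i).map fun v => v.1 (E i)) (med i)) :
    ∫⁻ v, optWelfare v ∂(Measure.pi F) +
        4 * ∫⁻ v, ENNReal.ofReal (welfare v E) ∂(Measure.pi F) ≤
      8 * (combMedian r).expWelfare F +
        4 * (ENNReal.ofReal (harmonic (Finset.univ.sup fun i => (E i).card) : ℝ) *
          ∫⁻ v, ENNReal.ofReal (welfare v E) ∂(Measure.pi F)) := by
  set h := ENNReal.ofReal (harmonic (Finset.univ.sup fun i => (E i).card) : ℝ)
  set x : N → ℝ≥0∞ := fun j => ∫⁻ v, ENNReal.ofReal ((v j).1 (E j)) ∂(Measure.pi F)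
  set L : ℝ≥0∞ := ∑ S : Finset N,
    ∫⁻ v, ENNReal.ofReal (welfare v ((combMedian r).alloc S v)) ∂(Measure.pi F)
  set n := Fintype.card N
  have hV : ∫⁻ v, ENNReal.ofReal (welfare v E) ∂(Measure.pi F) = ∑ j, x j := by
    rw [← lintegral_finsetSum _ fun j _ => measurable_ofReal_apply j _]
    refine lintegral_congr fun v => ?_
    rw [welfare, ENNReal.ofReal_sum_of_nonneg fun j _ => (v j).2.nonneg _]
  have hmedx : ∀ j, ENNReal.ofReal (med j) ≤ 2 * x j := fun j => by
    refine (hmed j).ofReal_le.trans (le_of_eq ?_)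
    rw [← (measurePreserving_eval F j).lintegral_comp
      (measurable_valuation_apply (E j)).ennreal_ofReal]
  have hsubsets : ∀ y : N → ℝ≥0∞, 2 * ∑ S : Finset N, ∑ j ∈ S, y j = 2 ^ n * ∑ j, y j := by
    intro y
    have := two_nsmul_sum_powerset Finset.univ y
    rw [nsmul_eq_mul, nsmul_eq_mul, Finset.powerset_univ, Finset.card_univ] at this
    exact_mod_cast this
  have hopt : 2 ^ n * ∫⁻ v, optWelfare v ∂(Measure.pi F) ≤
      4 * ∑ S : Finset N, ∫⁻ v, restrictedOpt E S S v ∂(Measure.pi F) := by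
    rw [← lintegral_finsetSum _ fun S _ => measurable_restrictedOpt S S,
      ← lintegral_const_mul' _ _ (by finiteness), ← lintegral_const_mul' _ _ (by finiteness)]
    exact lintegral_mono fun v => two_pow_card_mul_optWelfare_le hE v
  have hsum := Finset.sum_le_sum fun S (_ : S ∈ Finset.univ) =>
    lintegral_restrictedOpt_le r hE F hmed S
  rw [Finset.sum_add_distrib, Finset.sum_add_distrib, ← Finset.mul_sum, ← Finset.mul_sum,
    ← Finset.mul_sum, hsubsets x] at hsum
  have hscaled : 2 ^ n * (∫⁻ v, optWelfare v ∂(Measure.pi F) + 4 * ∑ j, x j) ≤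
      8 * L + 2 ^ n * (4 * (h * ∑ j, x j)) := by
    calc 2 ^ n * (∫⁻ v, optWelfare v ∂(Measure.pi F) + 4 * ∑ j, x j)
        = 2 ^ n * ∫⁻ v, optWelfare v ∂(Measure.pi F) + 4 * (2 ^ n * ∑ j, x j) := by ring
      _ ≤ 4 * ∑ S : Finset N, ∫⁻ v, restrictedOpt E S S v ∂(Measure.pi F) +
            4 * (2 ^ n * ∑ j, x j) := by gcongr
      _ ≤ 4 * (2 * L + h * ∑ S : Finset N, ∑ j ∈ S, ENNReal.ofReal (med j)) := by
          rw [← mul_add]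
          gcongr
      _ = 8 * L + 2 * h * (2 * ∑ S : Finset N, ∑ j ∈ S, ENNReal.ofReal (med j)) := by ring
      _ ≤ 8 * L + 2 * h * (2 ^ n * ∑ j, 2 * x j) := by
          rw [hsubsets]
          gcongr with j
          exact hmedx j
      _ = _ := by
          rw [← Finset.mul_sum]
          ring
  have hpow : (2⁻¹ : ℝ≥0∞) ^ n * 2 ^ n = 1 := by
    rw [← mul_pow, ENNReal.inv_mul_cancel (by simp) (by simp), one_pow]
  rw [hV]
  calc ∫⁻ v, optWelfare v ∂(Measure.pi F) + 4 * ∑ j, x j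
      = 2⁻¹ ^ n * (2 ^ n * (∫⁻ v, optWelfare v ∂(Measure.pi F) + 4 * ∑ j, x j)) := by
        rw [← mul_assoc, hpow, one_mul]
    _ ≤ 2⁻¹ ^ n * (8 * L + 2 ^ n * (4 * (h * ∑ j, x j))) := by gcongr
    _ = 8 * (2⁻¹ ^ n * L) + 2⁻¹ ^ n * 2 ^ n * (4 * (h * ∑ j, x j)) := by ring
    _ ≤ _ := by
        rw [hpow, one_mul]
        gcongr
        exact sum_lintegral_welfare_le r F

/-- If some item exists then `1 ≤ H_t`; otherwise `H_t = 0`, and the optimum is zero as well. -/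
theorem lintegral_optWelfare_le (hE : IsEndowment E)
    (F : N → Measure (Valuation M)) [∀ i, IsProbabilityMeasure (F i)]
    (hmed : ∀ i, IsMedian ((F i).map fun v => v.1 (E i)) (med i)) :
    ∫⁻ v, optWelfare v ∂(Measure.pi F) ≤
      ENNReal.ofReal (8 * (harmonic (Finset.univ.sup fun i => (E i).card) : ℝ)) *
        (combMedian r).expWelfare F := by
  rcases isEmpty_or_nonempty M with hM | ⟨⟨y⟩⟩
  · have hzero : ∀ v : N → Valuation M, optWelfare v = 0 := fun v => by
      simp [optWelfare, welfare, Finset.eq_empty_of_isEmpty, (v _).2.normalized]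
    simp [hzero]
  have ht : (Finset.univ.sup fun i => (E i).card) ≠ 0 := by
    obtain ⟨i, hi, _⟩ := hE y
    exact ((Finset.card_pos.2 ⟨y, hi⟩).trans_le
      (Finset.le_sup (f := fun i => (E i).card) (Finset.mem_univ i))).ne'
  have hmain := lintegral_optWelfare_add_le r hE F hmed
  have hVA := lintegral_welfare_endowment_le r F
  rw [ENNReal.ofReal_mul (by norm_num)]
  have h8 : ENNReal.ofReal 8 = 8 := by simp
  have h1 : 1 ≤ ENNReal.ofReal (harmonic (Finset.univ.sup fun i => (E i).card) : ℝ) := by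
    rw [ENNReal.one_le_ofReal]
    exact_mod_cast one_le_harmonic ht
  rw [h8]
  set h := ENNReal.ofReal (harmonic (Finset.univ.sup fun i => (E i).card) : ℝ)
  set V := ∫⁻ v, ENNReal.ofReal (welfare v E) ∂(Measure.pi F)
  set A := (combMedian r).expWelfare F
  -- For `V = ∞` the term `4 * V` cannot be cancelled, but then the right side is infinite.
  rcases eq_or_ne V ∞ with hV | hV
  · have hA : A = ∞ := top_le_iff.1 (hV ▸ hVA)
    have hne : 8 * h ≠ 0 := mul_ne_zero (by norm_num) (zero_lt_one.trans_le h1).ne'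
    rw [hA, ENNReal.mul_top hne]
    exact le_top
  · obtain ⟨k, hk⟩ := exists_add_of_le h1
    rw [hk] at hmain ⊢
    have hcancel : ∫⁻ v, optWelfare v ∂(Measure.pi F) + 4 * V ≤ (8 * A + 4 * (k * V)) + 4 * V :=
      hmain.trans (le_of_eq (by ring))
    calc ∫⁻ v, optWelfare v ∂(Measure.pi F) ≤ 8 * A + 4 * (k * V) :=
          (ENNReal.add_le_add_iff_right (by finiteness)).1 hcancel
      _ ≤ 8 * A + 8 * (k * A) := by
          gcongr
          norm_num
      _ = 8 * (1 + k) * A := by ring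

end Approximation

end CombExchange

theorem theorem4p1 {N M : Type*} [Fintype N] [DecidableEq N] [Fintype M] [DecidableEq M]
    (E : N → Finset M) (hE : CombExchange.IsEndowment E)
    (med : N → ℝ) (r : CombExchange.AuctionRule E med)
    (F : N → MeasureTheory.Measure (CombExchange.Valuation M))
    (hF : ∀ i, MeasureTheory.IsProbabilityMeasure (F i))
    (hmed : ∀ i, CombExchange.IsMedian ((F i).map fun v => v.1 (E i)) (med i)) :
    (CombExchange.combMedian r).Feasible ∧
    (CombExchange.combMedian r).Truthful ∧
    (CombExchange.combMedian r).ExPostIR E ∧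
    (CombExchange.combMedian r).WeaklyBudgetBalanced ∧
    ∫⁻ v, CombExchange.optWelfare v ∂(MeasureTheory.Measure.pi F) ≤
      ENNReal.ofReal (8 * (harmonic (Finset.univ.sup fun i => (E i).card) : ℝ)) *
        (CombExchange.combMedian r).expWelfare F :=
  ⟨CombExchange.combMedian_feasible r hE, CombExchange.combMedian_truthful r,
    CombExchange.combMedian_exPostIR r, CombExchange.combMedian_weaklyBudgetBalanced r,
    CombExchange.lintegral_optWelfare_le r hE F hmed⟩
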